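/- A nonnegative random variable $X$ with finite mean is called NBUE (new better than used in expectation) if $\mathbb{E}[X-s\mid X>s]\le \mathbb{E}X$ for all $s>0$ with $\mathbb{P}[X>s]>0$, and NWUE (new worse than used in expectation) if $\mathbb{E}[X-s\mid X>s]\ge \mathbb{E}X$ for all such $s$. A random variable $X^e$ (possibly on another probability space) has the equilibrium distribution with respect to $X$ if $\mathbb{E}f(X)-f(0)=\mathbb{E}X\,\mathbb{E}f'(X^e)$ for all Lipschitz $f:\mathbb{R}\to\mathbb{R}$. For probability measures $P,Q$ on $\mathbb{R}$ let $d_{\mathrm{K}}(P,Q)=\sup_{z\in\mathbb{R}}|P((-\infty,z])-Q((-\infty,z])|$ and let $d_{\mathrm{W}}(P,Q)=\sup_h|\int h\,dP-\int h\,dQ|$, the supremum being over all Lipschitz $h:\mathbb{R}\to\mathbb{R}$ with Lipschitz constant at most $1$. **Corollary.** Let $W$ be a nonnegative random variable that is NBUE or NWUE, with $\mathbb{E}W=1$ and finite second moment, and let $\rho=\left|\tfrac12\mathbb{E}W^2-1\right|$. Then $$d_{\mathrm{W}}(\mathscr{L}(W),\mathrm{Exp}(1))\le 2\rho,\qquad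 d_{\mathrm{K}}(\mathscr{L}(W),\mathrm{Exp}(1))\le 2.47\,\rho^{1/2},$$ and, for every $W^e$ that has the equilibrium distribution with respect to $W$, $$d_{\mathrm{W}}(\mathscr{L}(W^e),\mathrm{Exp}(1))\le \rho,\qquad d_{\mathrm{K}}(\mathscr{L}(W^e),\mathrm{Exp}(1))\le \rho.$$ -/

import Mathlib

open MeasureTheory ProbabilityTheory
open scoped ENNReal NNReal

/-- The test functions `I[· ≤ z]`, `z ∈ ℝ`, of the Kolmogorov distance. -/
def kolmogorovTests : Set (ℝ → ℝ) :=
  {f | ∃ z : ℝ, f = (Set.Iic z).indicator (fun _ => 1)}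

/-- The test functions of the Wasserstein distance: Lipschitz functions with constant `1`. -/
def wassersteinTests : Set (ℝ → ℝ) :=
  {h | LipschitzWith 1 h}

open Classical in
/-- The distance `sup_{f ∈ F} |∫ f dμ - ∫ f dν|` induced by a set `F` of test functions, as an
extended nonnegative real. If some test function is not integrable, then the distance is set
to `∞`, so that a finite bound on it says in particular that all the integrals are well defined. -/
noncomputable def testDist (F : Set (ℝ → ℝ)) (μ ν : Measure ℝ) : ℝ≥0∞ :=
  ⨆ f ∈ F, if Integrable f μ ∧ Integrable f ν then
    ENNReal.ofReal |(∫ x, f x ∂μ) - ∫ x, f x ∂ν| else ⊤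

/-- Kolmogorov distance. -/
noncomputable def dK (μ ν : Measure ℝ) : ℝ≥0∞ := testDist kolmogorovTests μ ν

/-- Wasserstein distance. -/
noncomputable def dW (μ ν : Measure ℝ) : ℝ≥0∞ := testDist wassersteinTests μ ν

/-- `X` is new better than used in expectation: it is nonnegative, has finite mean, and
`E[X - s | X > s] ≤ E[X]` for all `s > 0` for which the conditional expectation is defined,
that is, for which `X > s` has positive probability. -/
structure IsNBUE {Ω : Type*} [MeasurableSpace Ω] (X : Ω → ℝ) (P : Measure Ω) : Prop where
  nonneg : ∀ᵐ ω ∂P, 0 ≤ X ω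
  integrable : Integrable X P
  meanResidual_le : ∀ s : ℝ, 0 < s → P {ω | s < X ω} ≠ 0 →
    ∫ ω, (X ω - s) ∂(cond P {ω | s < X ω}) ≤ ∫ ω, X ω ∂P

/-- `X` is new worse than used in expectation: the same with the inequality reversed. -/
structure IsNWUE {Ω : Type*} [MeasurableSpace Ω] (X : Ω → ℝ) (P : Measure Ω) : Prop where
  nonneg : ∀ᵐ ω ∂P, 0 ≤ X ω
  integrable : Integrable X P
  le_meanResidual : ∀ s : ℝ, 0 < s → P {ω | s < X ω} ≠ 0 →
    ∫ ω, X ω ∂P ≤ ∫ ω, (X ω - s) ∂(cond P {ω | s < X ω})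

/-- The random variable `Xe` (on its own probability space) has the equilibrium distribution
with respect to `X`: `E f(X) - f(0) = E X * E f'(Xe)` for all Lipschitz `f`. -/
def HasEquilibriumDist {Ω Ω' : Type*} [MeasurableSpace Ω] [MeasurableSpace Ω']
    (Xe : Ω' → ℝ) (P' : Measure Ω') (X : Ω → ℝ) (P : Measure Ω) : Prop :=
  ∀ (K : ℝ≥0) (f : ℝ → ℝ), LipschitzWith K f →
    (∫ ω, f (X ω) ∂P) - f 0 = (∫ ω, X ω ∂P) * ∫ ω, deriv f (Xe ω) ∂P'

/-! Write F for the survival function of W, G(t) = E(W - t)⁺ for its stop-loss transform and E(t) =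
exp(-t). All three equal or are bounded by 1 at 0, and G is the integral of F over (t, ∞). Since E[W
- t | W > t] = G(t)/F(t), NBUE says G ≤ F and NWUE says F ≤ G. As G' = -F, this is a differential
inequality between G' and -G with G(0) = 1, so G ≤ E or E ≤ G respectively (`stopLoss_le_exp_neg`,
`exp_neg_le_stopLoss`).

Thus F - G and E - G have the same constant sign. On (0, ∞) both F and E integrate to 1 and G
integrates to E W²/2, so both differences have L¹ norm exactly ρ. Moreover E - G at t is the
integral of F - E over (0, t], which is dominated by that of |F - G|, so |E - G| ≤ ρ
(`stopLoss_estimates`).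

G is the survival function of W^e on [0, ∞), which gives both bounds for W^e, the Wasserstein
distance being at most the L¹ distance of survival functions. For W, the triangle inequality through
G gives 2ρ, and monotonicity of F gives (F - E)² ≤ 2ρ pointwise: a gap δ at one point forces a
triangle of area δ²/2 under |F - G|. -/

/-- The survival function `t ↦ μ (t, ∞)` of a measure on the line. -/
noncomputable def tail (μ : Measure ℝ) (t : ℝ) : ℝ := μ.real (Set.Ioi t)

/-- The stop-loss transform `t ↦ ∫ (x - t)⁺ dμ` of a measure on the line. -/
noncomputable def stopLoss (μ : Measure ℝ) (t : ℝ) : ℝ := ∫ x, max (x - t) 0 ∂μ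

/-! ### Survival functions and the two distances. -/

section Tail

variable {μ : Measure ℝ} [IsProbabilityMeasure μ]

lemma tail_nonneg (μ : Measure ℝ) (t : ℝ) : 0 ≤ tail μ t := measureReal_nonneg

lemma tail_le_one (μ : Measure ℝ) [IsProbabilityMeasure μ] (t : ℝ) : tail μ t ≤ 1 :=
  measureReal_le_one

lemma tail_antitone (μ : Measure ℝ) [IsProbabilityMeasure μ] : Antitone (tail μ) :=
  fun _ _ h => measureReal_mono (Set.Ioi_subset_Ioi h)

lemma measureReal_Iic_eq_one_sub_tail (μ : Measure ℝ) [IsProbabilityMeasure μ] (t : ℝ) :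
    μ.real (Set.Iic t) = 1 - tail μ t := by
  rw [tail, ← Set.compl_Iic, probReal_compl_eq_one_sub measurableSet_Iic]
  ring

lemma integrableOn_indicator_Iio {g : ℝ → ℝ} (hg : Measurable g) (hb : ∀ t, |g t| ≤ 1) (x : ℝ) :
    IntegrableOn (fun t => (Set.Iio x).indicator g t) (Set.Ioi 0) := by
  rw [integrableOn_indicator_iff measurableSet_Iio]
  refine IntegrableOn.mono_set (t := Set.Icc 0 x) ?_ (fun t ht => ⟨ht.2.le, ht.1.le⟩)
  exact Measure.integrableOn_of_bounded (M := 1) (by simp) hg.aestronglyMeasurable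
    (by filter_upwards with t using hb t)

lemma integral_indicator_Iio {x : ℝ} (hx : 0 ≤ x) (g : ℝ → ℝ) :
    ∫ t in Set.Ioi 0, (Set.Iio x).indicator g t = ∫ t in 0..x, g t := by
  rw [setIntegral_indicator measurableSet_Iio, intervalIntegral.integral_of_le hx,
    Set.Ioi_inter_Iio, integral_Ioc_eq_integral_Ioo]

lemma ae_nonneg_of_Iio_null {μ : Measure ℝ} (h0 : μ (Set.Iio 0) = 0) : ∀ᵐ x ∂μ, 0 ≤ x := by
  rw [ae_iff]
  simpa [Set.Iio] using h0

lemma integrable_prod_indicator_Iio {μ : Measure ℝ} [SFinite μ] (h0 : μ (Set.Iio 0) = 0) (hint : Integrable (fun x : ℝ => x) μ)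
    {g : ℝ → ℝ} (hg : Measurable g) (hb : ∀ t, |g t| ≤ 1) :
    Integrable (fun p : ℝ × ℝ => (Set.Iio p.1).indicator g p.2)
      (μ.prod (volume.restrict (Set.Ioi 0))) := by
  have hm : Measurable (fun p : ℝ × ℝ => (Set.Iio p.1).indicator g p.2) := by
    have : (fun p : ℝ × ℝ => (Set.Iio p.1).indicator g p.2)
        = {p : ℝ × ℝ | p.2 < p.1}.indicator (fun p => g p.2) := by
      ext p; simp [Set.indicator]
    rw [this]
    exact (hg.comp measurable_snd).indicator (measurableSet_lt measurable_snd measurable_fst)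
  rw [integrable_prod_iff hm.aestronglyMeasurable]
  refine ⟨.of_forall fun x => integrableOn_indicator_Iio hg hb x, ?_⟩
  refine hint.mono' (hm.norm.stronglyMeasurable.integral_prod_right').aestronglyMeasurable ?_
  filter_upwards [ae_nonneg_of_Iio_null h0] with x hx
  rw [Real.norm_of_nonneg (integral_nonneg fun _ => norm_nonneg _)]
  calc ∫ t in Set.Ioi 0, ‖(Set.Iio x).indicator g t‖
      ≤ ∫ t in Set.Ioi 0, (Set.Iio x).indicator (fun _ => (1 : ℝ)) t := by
        refine integral_mono (integrableOn_indicator_Iio hg hb x).norm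
          (integrableOn_indicator_Iio measurable_const (by simp) x) fun t => ?_
        by_cases h : t < x <;> simp [Set.indicator, h, hb]
    _ = x := by rw [integral_indicator_Iio hx]; simp

lemma integral_indicator_Iio_eq_mul_tail (μ : Measure ℝ) (g : ℝ → ℝ) (t : ℝ) :
    ∫ x, (Set.Iio x).indicator g t ∂μ = g t * tail μ t := by
  have : (fun x => (Set.Iio x).indicator g t) = (Set.Ioi t).indicator (fun _ => g t) := by
    ext x; simp [Set.indicator]
  rw [this, integral_indicator_const _ measurableSet_Ioi, tail, smul_eq_mul, mul_comm]

lemma integrableOn_mul_tail (h0 : μ (Set.Iio 0) = 0) (hint : Integrable (fun x : ℝ => x) μ)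
    {g : ℝ → ℝ} (hg : Measurable g) (hb : ∀ t, |g t| ≤ 1) :
    IntegrableOn (fun t => g t * tail μ t) (Set.Ioi 0) := by
  have h := (integrable_prod_indicator_Iio h0 hint hg hb).integral_prod_right
  simp only [integral_indicator_Iio_eq_mul_tail] at h
  exact h

/-- Fubini on the region 0 < t < x: the layer-cake formula with a bounded weight. -/
lemma integral_intervalIntegral_eq (h0 : μ (Set.Iio 0) = 0) (hint : Integrable (fun x : ℝ => x) μ)
    {g : ℝ → ℝ} (hg : Measurable g) (hb : ∀ t, |g t| ≤ 1) :
    ∫ x, (∫ t in 0..x, g t) ∂μ = ∫ t in Set.Ioi 0, g t * tail μ t := by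
  have h := integral_integral_swap (f := fun x t => (Set.Iio x).indicator g t)
    (integrable_prod_indicator_Iio h0 hint hg hb)
  simp only [integral_indicator_Iio_eq_mul_tail] at h
  rw [← h]
  refine integral_congr_ae ?_
  filter_upwards [ae_nonneg_of_Iio_null h0] with x hx
  rw [integral_indicator_Iio hx]

lemma integrableOn_tail (h0 : μ (Set.Iio 0) = 0) (hint : Integrable (fun x : ℝ => x) μ) :
    IntegrableOn (tail μ) (Set.Ioi 0) := by
  simpa using integrableOn_mul_tail h0 hint (g := fun _ => 1) measurable_const (by simp)

lemma integral_tail (h0 : μ (Set.Iio 0) = 0) (hint : Integrable (fun x : ℝ => x) μ) :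
    ∫ t in Set.Ioi 0, tail μ t = ∫ x, x ∂μ := by
  simpa using (integral_intervalIntegral_eq h0 hint (g := fun _ => 1) measurable_const
    (by simp)).symm

/-- A Lipschitz function is absolutely continuous, hence the integral of its derivative, and the
layer-cake formula applies with that derivative as weight. -/
lemma LipschitzWith.integral_eq_add_integral_deriv_mul_tail (h0 : μ (Set.Iio 0) = 0)
    (hint : Integrable (fun x : ℝ => x) μ) {h : ℝ → ℝ} (hh : LipschitzWith 1 h) :
    Integrable h μ ∧ ∫ x, h x ∂μ = h 0 + ∫ t in Set.Ioi 0, deriv h t * tail μ t := by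
  have hb : ∀ t, |deriv h t| ≤ 1 := fun t => by
    simpa using norm_deriv_le_of_lipschitz (x₀ := t) hh
  have hi : Integrable h μ := by
    refine ((integrable_const |h 0|).add hint.norm).mono' hh.continuous.aestronglyMeasurable
      (.of_forall fun x => ?_)
    have := hh.dist_le_mul x 0
    simp only [Real.dist_eq, sub_zero, NNReal.coe_one, one_mul] at this
    simp only [Real.norm_eq_abs, Pi.add_apply]
    linarith [abs_sub_abs_le_abs_sub (h x) (h 0)]
  refine ⟨hi, ?_⟩
  rw [← integral_intervalIntegral_eq h0 hint (measurable_deriv h) hb]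
  have hftc : ∀ x, ∫ t in 0..x, deriv h t = h x - h 0 := fun x =>
    ((hh.lipschitzOnWith (s := Set.uIcc 0 x)).absolutelyContinuousOnInterval).integral_deriv_eq_sub
  simp only [hftc]
  rw [integral_sub hi (integrable_const _)]
  simp

lemma dW_le_integral_tail {ν : Measure ℝ} [IsProbabilityMeasure ν]
    (hμ : μ (Set.Iio 0) = 0) (hν : ν (Set.Iio 0) = 0)
    (iμ : Integrable (fun x : ℝ => x) μ) (iν : Integrable (fun x : ℝ => x) ν) :
    dW μ ν ≤ ENNReal.ofReal (∫ t in Set.Ioi 0, |tail μ t - tail ν t|) := by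
  refine iSup₂_le fun h hh => ?_
  obtain ⟨i1, e1⟩ := LipschitzWith.integral_eq_add_integral_deriv_mul_tail hμ iμ hh
  obtain ⟨i2, e2⟩ := LipschitzWith.integral_eq_add_integral_deriv_mul_tail hν iν hh
  have hb : ∀ t, |deriv h t| ≤ 1 := fun t => by
    simpa using norm_deriv_le_of_lipschitz (x₀ := t) hh
  rw [if_pos ⟨i1, i2⟩, e1, e2]
  refine ENNReal.ofReal_le_ofReal ?_
  rw [add_sub_add_left_eq_sub, ← integral_sub (integrableOn_mul_tail hμ iμ (measurable_deriv h) hb)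
    (integrableOn_mul_tail hν iν (measurable_deriv h) hb)]
  refine (abs_integral_le_integral_abs).trans ?_
  refine integral_mono_of_nonneg (.of_forall fun _ => abs_nonneg _)
    ((integrableOn_tail hμ iμ).sub (integrableOn_tail hν iν)).abs (.of_forall fun t => ?_)
  beta_reduce
  rw [← mul_sub, abs_mul]
  exact mul_le_of_le_one_left (abs_nonneg _) (hb t)

lemma tail_of_neg (h0 : μ (Set.Iio 0) = 0) {t : ℝ} (ht : t < 0) : tail μ t = 1 := by
  have : μ.real (Set.Iic t) = 0 := by
    rw [Measure.real, measure_mono_null (Set.Iic_subset_Iio.2 ht) h0, ENNReal.toReal_zero]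
  linarith [measureReal_Iic_eq_one_sub_tail μ t]

lemma dK_le_of_tail {ν : Measure ℝ} [IsProbabilityMeasure ν]
    (hμ : μ (Set.Iio 0) = 0) (hν : ν (Set.Iio 0) = 0) {c : ℝ}
    (hc : ∀ t, 0 ≤ t → |tail μ t - tail ν t| ≤ c) :
    dK μ ν ≤ ENNReal.ofReal c := by
  refine iSup₂_le fun f hf => ?_
  obtain ⟨z, rfl⟩ := hf
  have hi : ∀ (κ : Measure ℝ) [IsProbabilityMeasure κ],
      Integrable ((Set.Iic z).indicator (fun _ => (1 : ℝ))) κ := fun κ _ =>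
    (integrable_const 1).indicator measurableSet_Iic
  rw [if_pos ⟨hi μ, hi ν⟩, integral_indicator_const _ measurableSet_Iic,
    integral_indicator_const _ measurableSet_Iic]
  refine ENNReal.ofReal_le_ofReal ?_
  simp only [smul_eq_mul, mul_one, measureReal_Iic_eq_one_sub_tail]
  rw [sub_sub_sub_cancel_left, abs_sub_comm]
  rcases lt_or_ge z 0 with hz | hz
  · rw [tail_of_neg hμ hz, tail_of_neg hν hz, sub_self, abs_zero]
    exact (abs_nonneg _).trans (hc 0 le_rfl)
  · exact hc z hz

lemma integrable_id_of_integrableOn_tail (h0 : μ (Set.Iio 0) = 0)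
    (hi : IntegrableOn (tail μ) (Set.Ioi 0)) : Integrable (fun x : ℝ => x) μ := by
  refine ⟨aestronglyMeasurable_id, ?_⟩
  rw [hasFiniteIntegral_iff_ofReal (ae_nonneg_of_Iio_null h0)]
  have h := lintegral_eq_lintegral_meas_lt μ (f := fun x => x) (ae_nonneg_of_Iio_null h0) aemeasurable_id
  rw [h]
  have := hi.lintegral_lt_top
  convert this using 3 with t
  simp [tail, Set.Ioi]

end Tail

/-! ### The exponential law. -/

section Exponential

instance isProbabilityMeasure_expMeasure_one : IsProbabilityMeasure (expMeasure 1) :=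
  isProbabilityMeasure_expMeasure one_pos

lemma tail_expMeasure_one {t : ℝ} (ht : 0 ≤ t) : tail (expMeasure 1) t = Real.exp (-t) := by
  have h1 := measureReal_Iic_eq_one_sub_tail (expMeasure 1) t
  have h2 := cdf_expMeasure_eq one_pos t
  rw [if_pos ht, cdf_eq_real, h1, one_mul] at h2
  linarith

lemma expMeasure_one_Iio_zero : expMeasure 1 (Set.Iio 0) = 0 := by
  have h2 := tail_expMeasure_one le_rfl
  have h1 := measureReal_Iic_eq_one_sub_tail (expMeasure 1) 0
  rw [h2, neg_zero, Real.exp_zero, sub_self, measureReal_eq_zero_iff] at h1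
  exact measure_mono_null Set.Iio_subset_Iic_self h1

lemma integrable_id_expMeasure_one : Integrable (fun x : ℝ => x) (expMeasure 1) := by
  refine integrable_id_of_integrableOn_tail expMeasure_one_Iio_zero ?_
  exact (integrableOn_exp_neg_Ioi 0).congr_fun
    (fun t ht => (tail_expMeasure_one (le_of_lt ht)).symm) measurableSet_Ioi

end Exponential

/-! ### The stop-loss transform. -/

section StopLoss

variable {μ : Measure ℝ} [IsProbabilityMeasure μ]

lemma integrable_max_sub (hint : Integrable (fun x : ℝ => x) μ) (t : ℝ) :
    Integrable (fun x => max (x - t) 0) μ :=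
  (hint.sub (integrable_const t)).pos_part

/-- With `le_stopLoss_sub`, a difference-quotient form of G' = -F that needs no differentiability,
which can fail at atoms. -/
lemma stopLoss_sub_le (hint : Integrable (fun x : ℝ => x) μ) {a b : ℝ} (hab : a ≤ b) :
    stopLoss μ a - stopLoss μ b ≤ (b - a) * tail μ a := by
  rw [stopLoss, stopLoss, ← integral_sub (integrable_max_sub hint a) (integrable_max_sub hint b)]
  have : (b - a) * tail μ a = ∫ x, (Set.Ioi a).indicator (fun _ => b - a) x ∂μ := by
    rw [integral_indicator_const _ measurableSet_Ioi, tail, smul_eq_mul, mul_comm]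
  rw [this]
  refine integral_mono ((integrable_max_sub hint a).sub (integrable_max_sub hint b))
    ((integrable_const _).indicator measurableSet_Ioi) fun x => ?_
  simp only [Set.indicator, Set.mem_Ioi]
  grind

lemma le_stopLoss_sub (hint : Integrable (fun x : ℝ => x) μ) {a b : ℝ} (hab : a ≤ b) :
    (b - a) * tail μ b ≤ stopLoss μ a - stopLoss μ b := by
  rw [stopLoss, stopLoss, ← integral_sub (integrable_max_sub hint a) (integrable_max_sub hint b)]
  have : (b - a) * tail μ b = ∫ x, (Set.Ioi b).indicator (fun _ => b - a) x ∂μ := by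
    rw [integral_indicator_const _ measurableSet_Ioi, tail, smul_eq_mul, mul_comm]
  rw [this]
  refine integral_mono ((integrable_const _).indicator measurableSet_Ioi)
    ((integrable_max_sub hint a).sub (integrable_max_sub hint b)) fun x => ?_
  simp only [Set.indicator, Set.mem_Ioi]
  grind

lemma stopLoss_nonneg (μ : Measure ℝ) (t : ℝ) : 0 ≤ stopLoss μ t :=
  integral_nonneg fun _ => le_max_right _ _

lemma stopLoss_of_nonpos (h0 : μ (Set.Iio 0) = 0) (hint : Integrable (fun x : ℝ => x) μ) {t : ℝ} (ht : t ≤ 0) :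
    stopLoss μ t = (∫ x, x ∂μ) - t := by
  have : stopLoss μ t = ∫ x, (x - t) ∂μ := by
    refine integral_congr_ae ?_
    filter_upwards [ae_nonneg_of_Iio_null h0] with x hx
    exact max_eq_left (by linarith)
  rw [this, integral_sub hint (integrable_const _)]
  simp

lemma integral_tail_Ioc (h0 : μ (Set.Iio 0) = 0) (hint : Integrable (fun x : ℝ => x) μ) {t : ℝ} (ht : 0 ≤ t) :
    ∫ s in Set.Ioc 0 t, tail μ s = (∫ x, x ∂μ) - stopLoss μ t := by
  have h := integral_intervalIntegral_eq h0 hint (g := (Set.Iic t).indicator 1)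
    (measurable_one.indicator measurableSet_Iic)
    (fun s => by by_cases hs : s ≤ t <;> simp [Set.indicator, hs])
  have e1 : ∀ x, 0 ≤ x → ∫ s in 0..x, (Set.Iic t).indicator (1 : ℝ → ℝ) s = x - max (x - t) 0 := by
    intro x hx
    rw [intervalIntegral.integral_of_le hx, setIntegral_indicator measurableSet_Iic,
      Set.Ioc_inter_Iic]
    simp only [Pi.one_apply, integral_const, smul_eq_mul, mul_one, measureReal_restrict_apply_univ,
      Real.volume_real_Ioc]
    grind
  have e2 : (fun s => (Set.Iic t).indicator (1 : ℝ → ℝ) s * tail μ s)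
      = (Set.Iic t).indicator (tail μ) := by
    ext s; by_cases hs : s ≤ t <;> simp [Set.indicator, hs]
  rw [e2, setIntegral_indicator measurableSet_Iic, Set.Ioi_inter_Iic] at h
  rw [← h, stopLoss, ← integral_sub hint (integrable_max_sub hint t)]
  refine integral_congr_ae ?_
  filter_upwards [ae_nonneg_of_Iio_null h0] with x hx
  exact e1 x hx

lemma integral_max_sub_Ioi {x : ℝ} (hx : 0 ≤ x) :
    IntegrableOn (fun t => max (x - t) 0) (Set.Ioi 0) ∧
      ∫ t in Set.Ioi 0, max (x - t) 0 = x ^ 2 / 2 := by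
  have hz : ∀ t ∈ Set.Ioi 0 \ Set.Ioc 0 x, max (x - t) 0 = 0 := fun t ht => by
    simp only [Set.mem_sdiff, Set.mem_Ioi, Set.mem_Ioc, not_and, not_le] at ht
    exact max_eq_right (by linarith [ht.2 ht.1])
  have hc : Continuous fun t : ℝ => max (x - t) 0 := by fun_prop
  refine ⟨(hc.integrableOn_Ioc (a := 0) (b := x)).of_forall_sdiff_eq_zero measurableSet_Ioi hz, ?_⟩
  rw [setIntegral_eq_of_subset_of_forall_sdiff_eq_zero measurableSet_Ioi
    Set.Ioc_subset_Ioi_self hz, setIntegral_congr_fun (g := fun t => x - t) measurableSet_Ioc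
    (fun t ht => max_eq_left (by linarith [ht.2])), ← intervalIntegral.integral_of_le hx,
    intervalIntegral.integral_sub (by simp) (by simp)]
  simp
  ring

lemma integral_stopLoss (h0 : μ (Set.Iio 0) = 0) (hsq : Integrable (fun x => x ^ 2) μ) :
    IntegrableOn (stopLoss μ) (Set.Ioi 0) ∧
      ∫ t in Set.Ioi 0, stopLoss μ t = (1 / 2) * ∫ x, x ^ 2 ∂μ := by
  have hint : Integrable (fun p : ℝ × ℝ => max (p.1 - p.2) 0)
      (μ.prod (volume.restrict (Set.Ioi 0))) := by
    have hm : Measurable fun p : ℝ × ℝ => max (p.1 - p.2) 0 := by fun_prop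
    rw [integrable_prod_iff hm.aestronglyMeasurable]
    constructor
    · filter_upwards [ae_nonneg_of_Iio_null h0] with x hx using (integral_max_sub_Ioi hx).1
    · refine (hsq.div_const 2).congr ?_
      filter_upwards [ae_nonneg_of_Iio_null h0] with x hx
      rw [← (integral_max_sub_Ioi hx).2]
      simp only [Real.norm_of_nonneg (le_max_right _ _)]
  refine ⟨hint.integral_prod_right, ?_⟩
  have h := integral_integral_swap (f := fun x t => max (x - t) 0) hint
  simp only [stopLoss]
  rw [← h, ← integral_const_mul]
  refine integral_congr_ae ?_
  filter_upwards [ae_nonneg_of_Iio_null h0] with x hx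
  rw [(integral_max_sub_Ioi hx).2]
  ring

end StopLoss

/-! ### Comparison of survival function, stop-loss transform and exponential. -/

lemma exp_neg_sub_exp_neg_le {s t : ℝ} (hs : 0 ≤ s) (hst : s ≤ t) :
    Real.exp (-s) - Real.exp (-t) ≤ t - s := by
  have h1 : Real.exp (-t) = Real.exp (-s) * Real.exp (-(t - s)) := by
    rw [← Real.exp_add]; congr 1; ring
  have h2 := Real.add_one_le_exp (-(t - s))
  have h3 : Real.exp (-s) ≤ 1 := Real.exp_le_one_iff.2 (by linarith)
  have h4 := Real.exp_pos (-s)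
  rw [h1]
  nlinarith

lemma intervalIntegral_le_setIntegral_Ioi {g φ : ℝ → ℝ} (hg : IntegrableOn g (Set.Ioi 0))
    (hg0 : ∀ s, 0 < s → 0 ≤ g s) (hφ : Continuous φ) {a b : ℝ} (ha : 0 ≤ a) (hab : a ≤ b)
    (h : ∀ s, a < s → s ≤ b → φ s ≤ g s) :
    ∫ s in a..b, φ s ≤ ∫ s in Set.Ioi 0, g s := by
  have hsub : Set.Ioc a b ⊆ Set.Ioi 0 := fun s hs => ha.trans_lt hs.1
  rw [intervalIntegral.integral_of_le hab]
  calc ∫ s in Set.Ioc a b, φ s ≤ ∫ s in Set.Ioc a b, g s :=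
        setIntegral_mono_on hφ.integrableOn_Ioc (hg.mono_set hsub) measurableSet_Ioc
          fun s hs => h s hs.1 hs.2
    _ ≤ ∫ s in Set.Ioi 0, g s := by
        refine setIntegral_mono_set hg ?_ hsub.eventuallyLE
        filter_upwards [ae_restrict_mem measurableSet_Ioi] with s hs using hg0 s hs

section ExponentialComparison

variable {μ : Measure ℝ} [IsProbabilityMeasure μ]

/-- A discrete Grönwall argument: an implicit Euler step of size h gives (1 + h) G(s + h) ≤ G(s);
take n steps of size t/n and let n → ∞. -/
lemma stopLoss_le_exp_neg (h0 : μ (Set.Iio 0) = 0) (hint : Integrable (fun x : ℝ => x) μ)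
    (hm : ∫ x, x ∂μ = 1) (hle : ∀ t, 0 ≤ t → stopLoss μ t ≤ tail μ t) {t : ℝ} (ht : 0 ≤ t) :
    stopLoss μ t ≤ Real.exp (-t) := by
  have hpow : ∀ (n : ℕ) (h : ℝ), 0 ≤ h → (1 + h) ^ n * stopLoss μ (n * h) ≤ 1 := by
    intro n h hh
    induction n with
    | zero => simp [stopLoss_of_nonpos h0 hint le_rfl, hm]
    | succ k ih =>
      refine le_trans ?_ ih
      rw [pow_succ, mul_assoc]
      refine mul_le_mul_of_nonneg_left ?_ (by positivity)
      push_cast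
      have h1 := le_stopLoss_sub hint (a := k * h) (b := (k + 1) * h) (by linarith)
      have h2 := mul_le_mul_of_nonneg_left (hle ((k + 1) * h) (by positivity)) hh
      linarith
  have hlim := (Real.tendsto_one_add_div_pow_exp t).mul_const (stopLoss μ t)
  have h1 : Real.exp t * stopLoss μ t ≤ 1 := by
    refine le_of_tendsto hlim ?_
    filter_upwards [Filter.eventually_gt_atTop 0] with n hn
    have := hpow n (t / n) (by positivity)
    rwa [mul_div_cancel₀ _ (by positivity)] at this
  rw [Real.exp_neg, ← one_div, le_div_iff₀ (Real.exp_pos t)]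
  linarith

/-- The explicit Euler step G(s + h) ≥ (1 - h) G(s), iterated in the same way. -/
lemma exp_neg_le_stopLoss (h0 : μ (Set.Iio 0) = 0) (hint : Integrable (fun x : ℝ => x) μ)
    (hm : ∫ x, x ∂μ = 1) (hle : ∀ t, 0 ≤ t → tail μ t ≤ stopLoss μ t) {t : ℝ} (ht : 0 ≤ t) :
    Real.exp (-t) ≤ stopLoss μ t := by
  have hpow : ∀ (n : ℕ) (h : ℝ), 0 ≤ h → h ≤ 1 → (1 - h) ^ n ≤ stopLoss μ (n * h) := by
    intro n h hh hh1
    induction n with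
    | zero => simp [stopLoss_of_nonpos h0 hint le_rfl, hm]
    | succ k ih =>
      have h1 := stopLoss_sub_le hint (a := k * h) (b := (k + 1) * h) (by linarith)
      have h2 := mul_le_mul_of_nonneg_left (hle (k * h) (by positivity)) hh
      have h3 := mul_le_mul_of_nonneg_right ih (sub_nonneg.2 hh1)
      rw [pow_succ]
      push_cast
      linarith
  refine le_of_tendsto (Real.tendsto_one_add_div_pow_exp (-t)) ?_
  -- n ≥ t keeps the step t/n at most 1, so the factor 1 - h is nonnegative.
  filter_upwards [Filter.eventually_gt_atTop 0, Filter.eventually_ge_atTop ⌈t⌉₊] with n hn hnt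
  have hn' : (0 : ℝ) < n := by positivity
  have := hpow n (t / n) (by positivity) ((div_le_one hn').2 (Nat.ceil_le.1 hnt))
  rwa [mul_div_cancel₀ _ hn'.ne', sub_eq_add_neg, ← neg_div] at this

/-- If the differences of the survival function of `μ` and its stop-loss transform, and of
`exp (-t)` and the stop-loss transform, have the same constant sign, then all distances are
controlled by the second moment. -/
lemma stopLoss_estimates (h0 : μ (Set.Iio 0) = 0) (hint : Integrable (fun x : ℝ => x) μ)
    (hm : ∫ x, x ∂μ = 1) (hsq : Integrable (fun x => x ^ 2) μ) {σ : ℝ} (hσ : |σ| = 1)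
    (h1 : ∀ t, 0 ≤ t → 0 ≤ σ * (tail μ t - stopLoss μ t))
    (h2 : ∀ t, 0 ≤ t → 0 ≤ σ * (Real.exp (-t) - stopLoss μ t)) :
    ∫ t in Set.Ioi 0, |tail μ t - stopLoss μ t| = |(1 / 2) * (∫ x, x ^ 2 ∂μ) - 1| ∧
    ∫ t in Set.Ioi 0, |stopLoss μ t - Real.exp (-t)| = |(1 / 2) * (∫ x, x ^ 2 ∂μ) - 1| ∧
    ∀ t, 0 ≤ t → |stopLoss μ t - Real.exp (-t)| ≤ |(1 / 2) * (∫ x, x ^ 2 ∂μ) - 1| := by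
  have iF := integrableOn_tail h0 hint
  have eF := integral_tail h0 hint
  obtain ⟨iG, eG⟩ := integral_stopLoss h0 hsq
  have iE := integrableOn_exp_neg_Ioi 0
  have eE := integral_exp_neg_Ioi_zero
  have habs : ∀ {x : ℝ}, 0 ≤ σ * x → |x| = σ * x := fun {x} hx => by
    rw [← abs_of_nonneg hx, abs_mul, hσ, one_mul]
  -- Used for f = F and f = E. The constant sign lets the absolute value leave the integral.
  have key : ∀ {f : ℝ → ℝ}, IntegrableOn f (Set.Ioi 0) → ∫ t in Set.Ioi 0, f t = 1 →
      (∀ t, 0 ≤ t → 0 ≤ σ * (f t - stopLoss μ t)) →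
      ∫ t in Set.Ioi 0, |f t - stopLoss μ t| = |(1 / 2) * (∫ x, x ^ 2 ∂μ) - 1| := by
    intro f hf ef hs
    have e : ∫ t in Set.Ioi 0, |f t - stopLoss μ t| = σ * (1 - (1 / 2) * ∫ x, x ^ 2 ∂μ) := by
      rw [← eG, ← ef, ← integral_sub hf iG, ← integral_const_mul]
      exact setIntegral_congr_fun measurableSet_Ioi fun t ht => habs (hs t (le_of_lt ht))
    have hn : 0 ≤ σ * (1 - (1 / 2) * ∫ x, x ^ 2 ∂μ) := by
      rw [← e]; exact integral_nonneg fun _ => abs_nonneg _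
    rw [e, ← habs hn, abs_sub_comm]
  have k1 := key iF (eF.trans hm) h1
  refine ⟨k1, ?_, fun t ht => ?_⟩
  · simpa only [abs_sub_comm] using key iE eE h2
  · rw [abs_sub_comm, habs (h2 t ht), ← k1]
    have hsub : Set.Ioc 0 t ⊆ Set.Ioi 0 := fun s hs => hs.1
    have eFt := integral_tail_Ioc h0 hint ht
    have eEt : ∫ s in Set.Ioc 0 t, Real.exp (-s) = 1 - Real.exp (-t) := by
      rw [← intervalIntegral.integral_of_le ht, intervalIntegral.integral_comp_neg fun x => Real.exp x,
        integral_exp]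
      simp
    -- Integrating F - E up to t turns the L¹ bound on F - G into a pointwise one; σ(F - E) ≤ σ(F -
    -- G) because σ(E - G) ≥ 0.
    have e : σ * (Real.exp (-t) - stopLoss μ t)
        = ∫ s in Set.Ioc 0 t, σ * (tail μ s - Real.exp (-s)) := by
      rw [integral_const_mul, integral_sub (iF.mono_set hsub) (iE.mono_set hsub), eFt, eEt, hm]
      ring
    rw [e]
    calc ∫ s in Set.Ioc 0 t, σ * (tail μ s - Real.exp (-s))
        ≤ ∫ s in Set.Ioc 0 t, |tail μ s - stopLoss μ s| := by
          refine setIntegral_mono_on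
            (IntegrableOn.mono_set (t := Set.Ioi 0) ((iF.sub iE).const_mul σ) hsub)
            (IntegrableOn.mono_set (t := Set.Ioi 0) (iF.sub iG).abs hsub) measurableSet_Ioc fun s hs => ?_
          rw [habs (h1 s hs.1.le)]
          linarith [h2 s hs.1.le]
      _ ≤ _ := setIntegral_mono_set (iF.sub iG).abs (.of_forall fun _ => abs_nonneg _)
          hsub.eventuallyLE

lemma integral_linear_left (t δ : ℝ) : ∫ s in (t - δ)..t, (δ - (t - s)) = δ ^ 2 / 2 := by
  have : (fun s : ℝ => δ - (t - s)) = fun s => s - (t - δ) := by ext s; ring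
  rw [this, intervalIntegral.integral_comp_sub_right (fun x => x)]
  simp

lemma integral_linear_right (t δ : ℝ) : ∫ s in t..(t + δ), (δ - (s - t)) = δ ^ 2 / 2 := by
  have : (fun s : ℝ => δ - (s - t)) = fun s => (t + δ) - s := by ext s; ring
  rw [this, intervalIntegral.integral_comp_sub_left (fun x => x)]
  simp

/-- If F(t) exceeds E(t) by δ, then to the left of t the antitone F stays at least F(t), while G ≤ E
rises at most at slope 1. So F - G dominates a triangle of height and base δ. -/
lemma sq_tail_sub_exp_neg_le_of_stopLoss_le (h0 : μ (Set.Iio 0) = 0)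
    (hint : Integrable (fun x : ℝ => x) μ) (hsq : Integrable (fun x => x ^ 2) μ)
    (hle : ∀ t, 0 ≤ t → stopLoss μ t ≤ tail μ t)
    (hle' : ∀ t, 0 ≤ t → stopLoss μ t ≤ Real.exp (-t)) {ρ : ℝ}
    (hρ : ∫ t in Set.Ioi 0, |tail μ t - stopLoss μ t| = ρ)
    (hρ' : ∀ t, 0 ≤ t → |stopLoss μ t - Real.exp (-t)| ≤ ρ) {t : ℝ} (ht : 0 ≤ t) :
    (tail μ t - Real.exp (-t)) ^ 2 ≤ 2 * ρ := by
  have he1 : Real.exp (-t) ≤ 1 := Real.exp_le_one_iff.2 (by linarith)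
  rcases le_total (tail μ t) (Real.exp (-t)) with h | h
  -- Here G ≤ F ≤ E, so the gap is at most both ρ and 1.
  · have h1 := neg_le_of_abs_le (hρ' t ht)
    have h2 := hle t ht
    have h3 := tail_nonneg μ t
    nlinarith
  · set δ := tail μ t - Real.exp (-t) with hδ
    have hδ0 : 0 ≤ δ := sub_nonneg.2 h
    -- F ≤ 1 and 1 - exp(-t) ≤ t keep the window [t - δ, t] inside [0, ∞).
    have hδt : δ ≤ t := by
      have := Real.add_one_le_exp (-t)
      linarith [tail_le_one μ t]
    have hI := intervalIntegral_le_setIntegral_Ioi (φ := fun s => δ - (t - s)) (a := t - δ) (b := t)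
      ((integrableOn_tail h0 hint).sub (integral_stopLoss h0 hsq).1).abs
      (fun _ _ => abs_nonneg _) (by fun_prop) (by linarith) (by linarith) (fun s hs1 hs2 => by
        refine le_trans ?_ (le_abs_self _)
        have hs : 0 ≤ s := by linarith
        have := exp_neg_sub_exp_neg_le hs hs2
        simp only [Pi.sub_apply]
        linarith [tail_antitone μ hs2, hle' s hs])
    rw [integral_linear_left] at hI
    have : δ ^ 2 / 2 ≤ ρ := hI.trans_eq hρ
    linarith

/-- The mirror image: the triangle lies to the right of t, so no lower bound on t beyond 0 ≤ t is
needed. -/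
lemma sq_tail_sub_exp_neg_le_of_le_stopLoss (h0 : μ (Set.Iio 0) = 0)
    (hint : Integrable (fun x : ℝ => x) μ) (hsq : Integrable (fun x => x ^ 2) μ)
    (hle : ∀ t, 0 ≤ t → tail μ t ≤ stopLoss μ t)
    (hle' : ∀ t, 0 ≤ t → Real.exp (-t) ≤ stopLoss μ t) {ρ : ℝ}
    (hρ : ∫ t in Set.Ioi 0, |tail μ t - stopLoss μ t| = ρ)
    (hρ' : ∀ t, 0 ≤ t → |stopLoss μ t - Real.exp (-t)| ≤ ρ) {t : ℝ} (ht : 0 ≤ t) :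
    (tail μ t - Real.exp (-t)) ^ 2 ≤ 2 * ρ := by
  have he1 : Real.exp (-t) ≤ 1 := Real.exp_le_one_iff.2 (by linarith)
  rcases le_total (Real.exp (-t)) (tail μ t) with h | h
  · have h1 := le_of_abs_le (hρ' t ht)
    have h2 := hle t ht
    have h3 := tail_le_one μ t
    have h4 := Real.exp_pos (-t)
    nlinarith
  · rw [← neg_sq, neg_sub]
    set δ := Real.exp (-t) - tail μ t with hδ
    have hδ0 : 0 ≤ δ := sub_nonneg.2 h
    have hI := intervalIntegral_le_setIntegral_Ioi (φ := fun s => δ - (s - t)) (a := t) (b := t + δ)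
      ((integrableOn_tail h0 hint).sub (integral_stopLoss h0 hsq).1).abs
      (fun _ _ => abs_nonneg _) (by fun_prop) ht (by linarith) (fun s hs1 hs2 => by
        refine le_trans ?_ (neg_le_abs _)
        have := exp_neg_sub_exp_neg_le ht hs1.le
        simp only [Pi.sub_apply]
        linarith [tail_antitone μ hs1.le, hle' s (ht.trans hs1.le)])
    rw [integral_linear_right] at hI
    have : δ ^ 2 / 2 ≤ ρ := hI.trans_eq hρ
    linarith

/-- Extension to `t = 0` of the comparison of the stop-loss transform with the survival function. -/
lemma stopLoss_le_tail_of_pos (hint : Integrable (fun x : ℝ => x) μ)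
    (hle : ∀ t, 0 < t → stopLoss μ t ≤ tail μ t) {t : ℝ} (ht : 0 ≤ t) :
    stopLoss μ t ≤ tail μ t := by
  refine le_of_forall_pos_le_add fun ε hε => ?_
  -- G(t) ≤ G(t + ε) + εF(t) ≤ F(t + ε) + ε ≤ F(t) + ε.
  have h1 := stopLoss_sub_le hint (a := t) (b := t + ε) (by linarith)
  have h2 := hle (t + ε) (by linarith)
  have h3 := tail_antitone μ (show t ≤ t + ε by linarith)
  nlinarith [tail_le_one μ t]

lemma tail_le_stopLoss_of_pos (h0 : μ (Set.Iio 0) = 0) (hint : Integrable (fun x : ℝ => x) μ)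
    (hm : ∫ x, x ∂μ = 1) (hle : ∀ t, 0 < t → tail μ t ≤ stopLoss μ t) {t : ℝ} (ht : 0 ≤ t) :
    tail μ t ≤ stopLoss μ t := by
  rcases ht.eq_or_lt with rfl | ht
  · rw [stopLoss_of_nonpos h0 hint le_rfl, hm, sub_zero]
    exact tail_le_one μ 0
  · exact hle t ht

end ExponentialComparison

/-! ### From random variables to laws; the equilibrium distribution. -/

section RandomVariable

variable {Ω : Type*} [MeasurableSpace Ω] {P : Measure Ω}

lemma tail_map {X : Ω → ℝ} (hX : AEMeasurable X P) (s : ℝ) :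
    tail (P.map X) s = P.real {ω | s < X ω} := by
  rw [tail, map_measureReal_apply_of_aemeasurable hX measurableSet_Ioi]
  rfl

lemma stopLoss_map {X : Ω → ℝ} (hX : AEMeasurable X P) (s : ℝ) :
    stopLoss (P.map X) s = ∫ ω, max (X ω - s) 0 ∂P := by
  rw [stopLoss, integral_map hX (by fun_prop)]

lemma setIntegral_sub_eq_stopLoss {X : Ω → ℝ} (hX : AEMeasurable X P) (s : ℝ) :
    ∫ ω in {ω | s < X ω}, (X ω - s) ∂P = stopLoss (P.map X) s := by
  rw [stopLoss_map hX, ← integral_indicator₀ (nullMeasurableSet_lt aemeasurable_const hX)]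
  congr 1
  ext ω
  simp only [Set.indicator, Set.mem_ofPred_eq]
  grind

lemma integral_cond_sub_eq {X : Ω → ℝ} (hX : AEMeasurable X P) (s : ℝ) :
    ∫ ω, (X ω - s) ∂(cond P {ω | s < X ω}) = stopLoss (P.map X) s / tail (P.map X) s := by
  rw [ProbabilityTheory.cond, integral_smul_measure, setIntegral_sub_eq_stopLoss hX, tail_map hX, ENNReal.toReal_inv,
    smul_eq_mul, inv_mul_eq_div, Measure.real]

lemma stopLoss_eq_zero_of_measure_eq_zero {X : Ω → ℝ} (hX : AEMeasurable X P) {s : ℝ}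
    (h : P {ω | s < X ω} = 0) : stopLoss (P.map X) s = 0 := by
  rw [← setIntegral_sub_eq_stopLoss hX, setIntegral_measure_zero _ h]

lemma tail_map_pos [IsFiniteMeasure P] {X : Ω → ℝ} (hX : AEMeasurable X P) {s : ℝ}
    (h : P {ω | s < X ω} ≠ 0) : 0 < tail (P.map X) s := by
  rw [tail_map hX]
  exact ENNReal.toReal_pos h (measure_ne_top _ _)

lemma IsNBUE.stopLoss_le_tail [IsFiniteMeasure P] {X : Ω → ℝ} (h : IsNBUE X P)
    (hm : ∫ ω, X ω ∂P = 1) {s : ℝ} (hs : 0 < s) : stopLoss (P.map X) s ≤ tail (P.map X) s := by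
  have hX := h.integrable.aemeasurable
  by_cases h0 : P {ω | s < X ω} = 0
  · rw [stopLoss_eq_zero_of_measure_eq_zero hX h0]
    exact tail_nonneg _ _
  · have := h.meanResidual_le s hs h0
    rwa [integral_cond_sub_eq hX, hm, div_le_one (tail_map_pos hX h0)] at this

lemma IsNWUE.tail_le_stopLoss [IsFiniteMeasure P] {X : Ω → ℝ} (h : IsNWUE X P)
    (hm : ∫ ω, X ω ∂P = 1) {s : ℝ} (hs : 0 < s) : tail (P.map X) s ≤ stopLoss (P.map X) s := by
  have hX := h.integrable.aemeasurable
  by_cases h0 : P {ω | s < X ω} = 0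
  · rw [tail_map hX, Measure.real, h0]
    exact stopLoss_nonneg _ _
  · have := h.le_meanResidual s hs h0
    rwa [integral_cond_sub_eq hX, hm, one_le_div (tail_map_pos hX h0)] at this

lemma map_Iio_zero {X : Ω → ℝ} (hX : AEMeasurable X P) (h : ∀ᵐ ω ∂P, 0 ≤ X ω) :
    P.map X (Set.Iio 0) = 0 := by
  rw [Measure.map_apply_of_aemeasurable hX measurableSet_Iio]
  simpa [ae_iff, Set.preimage] using h

lemma deriv_max_sub_zero (s : ℝ) :
    deriv (fun x => max (x - s) 0) = (Set.Ioi s).indicator (fun _ : ℝ => (1 : ℝ)) := by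
  ext x
  rcases lt_trichotomy x s with h | rfl | h
  · have : (fun x => max (x - s) 0) =ᶠ[nhds x] fun _ => 0 := by
      filter_upwards [Iio_mem_nhds h] with y hy
      exact max_eq_right (by linarith [Set.mem_Iio.1 hy])
    rw [this.deriv_eq]
    simp [h.le]
  · have hnd : ¬ DifferentiableAt ℝ (fun y : ℝ => max (y - x) 0) x := by
      intro hd
      have h1 : HasDerivWithinAt (fun y : ℝ => max (y - x) 0) 1 (Set.Ici x) x :=
        ((hasDerivWithinAt_id x _).sub_const x).congr
          (fun y hy => max_eq_left (by simpa using hy)) (by simp)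
      have h2 : HasDerivWithinAt (fun y : ℝ => max (y - x) 0) 0 (Set.Iic x) x :=
        (hasDerivWithinAt_const x _ (0 : ℝ)).congr
          (fun y hy => max_eq_right (by simpa using hy)) (by simp)
      have e1 := (uniqueDiffWithinAt_Ici x).eq_deriv _ h1 hd.hasDerivAt.hasDerivWithinAt
      have e2 := (uniqueDiffWithinAt_Iic x).eq_deriv _ h2 hd.hasDerivAt.hasDerivWithinAt
      linarith
    -- The default value 0 of `deriv` at the kink matches the open ray, so the formula holds
    -- everywhere, even if the law has an atom at s.
    rw [deriv_zero_of_not_differentiableAt hnd]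
    simp
  · have : (fun x => max (x - s) 0) =ᶠ[nhds x] fun y => y - s := by
      filter_upwards [Ioi_mem_nhds h] with y hy
      exact max_eq_left (by linarith [Set.mem_Ioi.1 hy])
    rw [this.deriv_eq]
    simp [h]

/-- The survival function of the equilibrium distribution is the stop-loss transform. -/
lemma HasEquilibriumDist.tail_eq {Ω' : Type*} [MeasurableSpace Ω'] {P' : Measure Ω'}
    {X : Ω → ℝ} {Xe : Ω' → ℝ} (hX : AEMeasurable X P) (hXe : AEMeasurable Xe P')
    (hm : ∫ ω, X ω ∂P = 1) (h : HasEquilibriumDist Xe P' X P) (s : ℝ) :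
    tail (P'.map Xe) s = stopLoss (P.map X) s - max (-s) 0 := by
  have hlip : LipschitzWith 1 fun x : ℝ => max (x - s) 0 := by
    simpa using (LipschitzWith.id.sub (LipschitzWith.const s)).max_const 0
  have := h 1 _ hlip
  rw [deriv_max_sub_zero, hm, one_mul, zero_sub, ← stopLoss_map hX] at this
  rw [this, ← integral_map (f := (Set.Ioi s).indicator fun _ => (1 : ℝ)) hXe
    (measurable_const.indicator measurableSet_Ioi).aestronglyMeasurable,
    integral_indicator_const _ measurableSet_Ioi, tail, smul_eq_mul, mul_one]

/-- The survival function of the equilibrium law at 0 is G(0) = 1. -/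
lemma HasEquilibriumDist.map_Iio_zero [IsProbabilityMeasure P] {Ω' : Type*} [MeasurableSpace Ω']
    {P' : Measure Ω'} [IsProbabilityMeasure P']
    {X : Ω → ℝ} {Xe : Ω' → ℝ} (hX : AEMeasurable X P) (hXe : AEMeasurable Xe P')
    (h0 : P.map X (Set.Iio 0) = 0) (hint : Integrable (fun x : ℝ => x) (P.map X))
    (hm : ∫ ω, X ω ∂P = 1) (h : HasEquilibriumDist Xe P' X P) :
    P'.map Xe (Set.Iio 0) = 0 := by
  have := Measure.isProbabilityMeasure_map hX
  have := Measure.isProbabilityMeasure_map hXe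
  have h1 := measureReal_Iic_eq_one_sub_tail (P'.map Xe) 0
  rw [h.tail_eq hX hXe hm, stopLoss_of_nonpos h0 hint le_rfl,
    integral_map (f := fun x : ℝ => x) hX (by fun_prop)] at h1
  rw [hm, sub_zero, neg_zero, max_self, sub_zero, sub_self, measureReal_eq_zero_iff] at h1
  exact measure_mono_null Set.Iio_subset_Iic_self h1

end RandomVariable

/-! ### The four bounds. -/

theorem mainTheorem9 {Ω : Type*} [MeasurableSpace Ω] (P : Measure Ω) [IsProbabilityMeasure P]
    (W : Ω → ℝ) (hW : IsNBUE W P ∨ IsNWUE W P) (hmean : ∫ ω, W ω ∂P = 1) (hsq : MemLp W 2 P)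
    (ρ : ℝ) (hρ : ρ = |(1 / 2 : ℝ) * (∫ ω, W ω ^ 2 ∂P) - 1|) :
    dW (P.map W) (expMeasure 1) ≤ ENNReal.ofReal (2 * ρ) ∧
    dK (P.map W) (expMeasure 1) ≤ ENNReal.ofReal (2.47 * √ρ) ∧
    ∀ {Ω' : Type*} [MeasurableSpace Ω'] (P' : Measure Ω') [IsProbabilityMeasure P']
      (We : Ω' → ℝ), AEMeasurable We P' → HasEquilibriumDist We P' W P →
        dW (P'.map We) (expMeasure 1) ≤ ENNReal.ofReal ρ ∧
        dK (P'.map We) (expMeasure 1) ≤ ENNReal.ofReal ρ := by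
  have hWm : AEMeasurable W P := hsq.aestronglyMeasurable.aemeasurable
  have hWi : Integrable W P := hsq.integrable (by norm_num)
  have hprob : IsProbabilityMeasure (P.map W) := Measure.isProbabilityMeasure_map hWm
  have hnn : ∀ᵐ ω ∂P, 0 ≤ W ω := hW.elim (fun h => h.nonneg) (fun h => h.nonneg)
  have h0 : P.map W (Set.Iio 0) = 0 := map_Iio_zero hWm hnn
  have hint : Integrable (fun x : ℝ => x) (P.map W) :=
    (integrable_map_measure (by fun_prop) hWm).2 hWi
  have hm : ∫ x, x ∂(P.map W) = 1 := by rw [integral_map hWm (by fun_prop), hmean]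
  have hint2 : Integrable (fun x : ℝ => x ^ 2) (P.map W) :=
    (integrable_map_measure (by fun_prop) hWm).2 hsq.integrable_sq
  have hm2 : ∫ x, x ^ 2 ∂(P.map W) = ∫ ω, W ω ^ 2 ∂P := integral_map hWm (by fun_prop)
  obtain ⟨iG, -⟩ := integral_stopLoss h0 hint2
  obtain ⟨e1, e2, e3, e4⟩ :
      (∫ t in Set.Ioi 0, |tail (P.map W) t - stopLoss (P.map W) t| = ρ) ∧
      (∫ t in Set.Ioi 0, |stopLoss (P.map W) t - Real.exp (-t)| = ρ) ∧
      (∀ t, 0 ≤ t → |stopLoss (P.map W) t - Real.exp (-t)| ≤ ρ) ∧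
      ∀ t, 0 ≤ t → (tail (P.map W) t - Real.exp (-t)) ^ 2 ≤ 2 * ρ := by
    rw [← hm2] at hρ
    subst hρ
    rcases hW with hN | hN
    · have hle : ∀ t, 0 ≤ t → stopLoss (P.map W) t ≤ tail (P.map W) t := fun t ht =>
        stopLoss_le_tail_of_pos hint (fun s hs => hN.stopLoss_le_tail hmean hs) ht
      have hle' : ∀ t, 0 ≤ t → stopLoss (P.map W) t ≤ Real.exp (-t) := fun t ht =>
        stopLoss_le_exp_neg h0 hint hm hle ht
      obtain ⟨e1, e2, e3⟩ := stopLoss_estimates h0 hint hm hint2 (σ := 1) (by simp)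
        (fun t ht => by linarith [hle t ht]) (fun t ht => by linarith [hle' t ht])
      exact ⟨e1, e2, e3, fun t ht =>
        sq_tail_sub_exp_neg_le_of_stopLoss_le h0 hint hint2 hle hle' e1 e3 ht⟩
    · have hle : ∀ t, 0 ≤ t → tail (P.map W) t ≤ stopLoss (P.map W) t := fun t ht =>
        tail_le_stopLoss_of_pos h0 hint hm (fun s hs => hN.tail_le_stopLoss hmean hs) ht
      have hle' : ∀ t, 0 ≤ t → Real.exp (-t) ≤ stopLoss (P.map W) t := fun t ht =>
        exp_neg_le_stopLoss h0 hint hm hle ht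
      obtain ⟨e1, e2, e3⟩ := stopLoss_estimates h0 hint hm hint2 (σ := -1) (by simp)
        (fun t ht => by linarith [hle t ht]) (fun t ht => by linarith [hle' t ht])
      exact ⟨e1, e2, e3, fun t ht =>
        sq_tail_sub_exp_neg_le_of_le_stopLoss h0 hint hint2 hle hle' e1 e3 ht⟩
  have hρ0 : 0 ≤ ρ := hρ ▸ abs_nonneg _
  have iF := integrableOn_tail h0 hint
  have iE := integrableOn_exp_neg_Ioi 0
  refine ⟨?_, ?_, ?_⟩
  · refine (dW_le_integral_tail h0 expMeasure_one_Iio_zero hint integrable_id_expMeasure_one).trans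
      (ENNReal.ofReal_le_ofReal ?_)
    rw [two_mul]
    nth_rewrite 1 [← e1]
    have i1 : IntegrableOn (fun t => |tail (P.map W) t - stopLoss (P.map W) t|) (Set.Ioi 0) :=
      (iF.sub iG).abs
    have i2 : IntegrableOn (fun t => |stopLoss (P.map W) t - Real.exp (-t)|) (Set.Ioi 0) :=
      (iG.sub iE).abs
    rw [← e2, ← integral_add i1 i2]
    refine setIntegral_mono_on
      (iF.sub (integrableOn_tail expMeasure_one_Iio_zero integrable_id_expMeasure_one)).abs
      (i1.add i2) measurableSet_Ioi fun t ht => ?_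
    rw [tail_expMeasure_one (le_of_lt ht)]
    exact abs_sub_le _ _ _
  · refine dK_le_of_tail h0 expMeasure_one_Iio_zero fun t ht => ?_
    rw [tail_expMeasure_one ht]
    -- The argument yields the constant √2; only 2 ≤ 2.47² is used.
    refine abs_le_of_sq_le_sq ((e4 t ht).trans ?_) (by positivity)
    rw [mul_pow, Real.sq_sqrt hρ0]
    nlinarith
  · intro Ω' _ P' _ We hWe hE
    have hprob' : IsProbabilityMeasure (P'.map We) := Measure.isProbabilityMeasure_map hWe
    have h0' := hE.map_Iio_zero hWm hWe h0 hint hmean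
    have htail : ∀ t, 0 ≤ t → tail (P'.map We) t = stopLoss (P.map W) t := fun t ht => by
      rw [hE.tail_eq hWm hWe hmean, max_eq_right (by linarith), sub_zero]
    have hint' : Integrable (fun x : ℝ => x) (P'.map We) :=
      integrable_id_of_integrableOn_tail h0'
        (iG.congr_fun (fun t ht => (htail t (le_of_lt ht)).symm) measurableSet_Ioi)
    constructor
    · refine (dW_le_integral_tail h0' expMeasure_one_Iio_zero hint'
        integrable_id_expMeasure_one).trans (ENNReal.ofReal_le_ofReal (le_of_eq ?_))
      rw [← e2]
      refine setIntegral_congr_fun measurableSet_Ioi fun t ht => ?_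
      simp only [htail t (le_of_lt ht), tail_expMeasure_one (le_of_lt ht)]
    · refine dK_le_of_tail h0' expMeasure_one_Iio_zero fun t ht => ?_
      rw [htail t ht, tail_expMeasure_one ht]
      exact e3 t ht
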